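/- **Theorem 4.** Let $G=(V,E)$ be a probabilistic social network under the independent cascade model, i.e. a directed graph with $n=|V|\ge 2$ nodes and $m=|E|$ edges in which every edge $e$ has a propagation probability $p(e)\in(0,1]$; a random realization of $G$ keeps each edge $e$ live independently with probability $p(e)$. Let $\eta\in\{1,\dots,n\}$ be the target and $\varepsilon\in(0,1)$ the error threshold, and assume that $\varepsilon$ is at least inverse polynomial in $n$, i.e. $\varepsilon\ge n^{-\kappa}$ for a fixed $\kappa\in\mathbb N$. Then the adaptive seed minimization algorithm ASTI, instantiated with TRIM, has expected running time $$O\!\left(\frac{\eta\,(m+n)}{\varepsilon^{2}}\,\ln n\right),$$ where the hidden constant depends only on $\kappa$, and the expectation is over the random realization of $G$ and the internal randomness of the algorithm. The running time is the number of unit-cost steps, where a coin flip, a random choice of a node, an operation on real numbers, and an operation on a queue, mark, counter or list entry cost $O(1)$. Here ASTI proceeds in rounds, starting from $G_1=G$. In round $i$, with $G_i$ the residual graph (the subgraph induced by the $n_i$ nodes that are still inactive) and $\eta_i=\eta-(n-n_i)$, it selects the seed $s_i$ returned by TRIM$(G_i,\varepsilon)$, observes the nodes that $s_i$ reaches along live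 edges in $G_i$, and removes them to obtain $G_{i+1}$; it stops once at least $\eta$ nodes are active. A random mRR-set of $G_i$ is generated by drawing $k=\lfloor n_i/\eta_i\rfloor+1$ with probability $n_i/\eta_i-\lfloor n_i/\eta_i\rfloor$ and $k=\lfloor n_i/\eta_i\rfloor$ otherwise, drawing a uniformly random set of $k$ nodes of $G_i$, and performing from these nodes a stochastic reverse breadth-first search, in which every incoming edge $e$ of a visited node is live with probability $p(e)$; the mRR-set is the set of visited nodes. TRIM$(G_i,\varepsilon)$ sets $\delta=\frac{\varepsilon}{100(1-1/e)(1-\varepsilon)\eta_i}$, $\hat\varepsilon=\frac{99\varepsilon}{100-\varepsilon}$, $\theta_{\max}=2n_i\big(\sqrt{\ln(6/\delta)}+\sqrt{\ln n_i+\ln(6/\delta)}\big)^2\hat\varepsilon^{-2}$, $\theta_\circ=\theta_{\max}\hat\varepsilon^{2}/n_i$, $T=\lceil\log_2(\theta_{\max}/\theta_\circ)\rceil+1$, $a_1=\ln(3T/\delta)+\ln n_i$ and $a_2=\ln(3T/\delta)$, and generates a collection $\mathcal R$ of $\lceil\theta_\circ\rceil$ random mRR-sets. For $t=1,\dots,T$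 it finds a node $v^*$ of $G_i$ that is contained in the largest number $\Lambda$ of sets in $\mathcal R$, computes $\Lambda^l=(\sqrt{\Lambda+2a_1/9}-\sqrt{a_1/2})^2-a_1/18$ and $\Lambda^u=(\sqrt{\Lambda+a_2/2}+\sqrt{a_2/2})^2$, returns $v^*$ if $\Lambda^l/\Lambda^u\ge 1-\hat\varepsilon$ or $t=T$, and otherwise doubles the size of $\mathcal R$ with further independent random mRR-sets. -/

import Mathlib

open scoped ENNReal

/-! ### Probabilistic social networks -/

/-- A probabilistic social network with node set `V`: a set of directed edges `(u, v)`, each of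
which carries a propagation probability in `(0, 1]`. -/
structure SocialNetwork (V : Type*) where
  edges : Finset (V × V)
  prob : V × V → ℝ
  prob_pos : ∀ e ∈ edges, 0 < prob e
  prob_le_one : ∀ e ∈ edges, prob e ≤ 1

namespace SocialNetwork

variable {V : Type*} [DecidableEq V]

/-- The edges of the subgraph of `G` induced by the node set `U`. -/
def inducedEdges (G : SocialNetwork V) (U : Finset V) : Finset (V × V) :=
  G.edges.filter fun e => e.1 ∈ U ∧ e.2 ∈ U

/-- The incoming edges of `u` in the subgraph of `G` induced by `U`. -/
def inEdges (G : SocialNetwork V) (U : Finset V) (u : V) : Finset (V × V) :=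
  (G.inducedEdges U).filter fun e => e.2 = u

/-- The probability of the realization whose set of live edges is `φ` (for `φ ⊆ G.edges`): edges
are live independently, the edge `e` with probability `G.prob e`. -/
def realizationProb (G : SocialNetwork V) (φ : Finset (V × V)) : ℝ :=
  (∏ e ∈ φ, G.prob e) * ∏ e ∈ G.edges \ φ, (1 - G.prob e)

end SocialNetwork

open Classical in
/-- The nodes activated by the seed `s` in the subgraph induced by `U` when `φ` is the set of live
edges: those reachable from `s` along live edges inside `U`. -/
noncomputable def activated {V : Type*} (φ : Finset (V × V)) (U : Finset V) (s : V) : Finset V :=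
  U.filter fun w => Relation.ReflTransGen (fun a b => (a, b) ∈ φ ∧ a ∈ U ∧ b ∈ U) s w

open Classical in
theorem activated_subset {V : Type*} (φ : Finset (V × V)) (U : Finset V) (s : V) :
    activated φ U s ⊆ U := Finset.filter_subset _ _

open Classical in
theorem mem_activated_self {V : Type*} (φ : Finset (V × V)) {U : Finset V} {s : V} (hs : s ∈ U) :
    s ∈ activated φ U s := Finset.mem_filter.2 ⟨hs, Relation.ReflTransGen.refl⟩

/-! ### Randomized computations with a step count -/

/-- A randomized computation: the joint law of its result and of the number of steps it makes. -/
abbrev Timed (α : Type*) := PMF (α × ℕ)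

namespace Timed

variable {α β : Type*}

/-- Return a value without spending any step. -/
noncomputable def ret (a : α) : Timed α := PMF.pure (a, 0)

/-- Run `x`, then the computation `f` selected by the result of `x`; the steps add up. -/
noncomputable def bind (x : Timed α) (f : α → Timed β) : Timed β :=
  PMF.bind x fun a =>
    PMF.bind (f a.1) fun b => PMF.pure (b.1, a.2 + b.2)

/-- Spend `c` steps, then run `x`. -/
noncomputable def tick (c : ℕ) (x : Timed α) : Timed α :=
  PMF.bind x fun a => PMF.pure (a.1, c + a.2)

/-- Draw from a distribution, at a cost of `c` steps. -/
noncomputable def sample (c : ℕ) (d : PMF α) : Timed α :=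
  PMF.bind d fun a => PMF.pure (a, c)

/-- The expected number of steps. -/
noncomputable def expectedSteps (x : Timed α) : ℝ≥0∞ :=
  ∑' a : α × ℕ, x a * (a.2 : ℝ≥0∞)

end Timed

/-- A coin of head probability `p` (clamped to `[0, 1]`, so that it is defined for all reals). -/
noncomputable def coin (p : ℝ) : PMF Bool :=
  PMF.ofFintype (fun b => if b then ENNReal.ofReal (max 0 (min p 1))
    else ENNReal.ofReal (1 - max 0 (min p 1))) (by
    have h : max 0 (min p 1) ≤ 1 := max_le zero_le_one (min_le_right _ _)
    simp only [Fintype.univ_bool, Finset.mem_singleton, Bool.true_eq_false, not_false_eq_true,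
      Finset.sum_insert, Finset.sum_singleton, if_true, Bool.false_eq_true, if_false]
    rw [← ENNReal.ofReal_add (le_max_left _ _) (sub_nonneg.2 h)]
    simp)

section Algorithm

variable {V : Type*} [Fintype V] [DecidableEq V]

/-! ### Multi-root reverse reachable sets -/

/-- The stochastic reverse breadth-first search in the subgraph induced by `U`. The list `pending`
holds the incoming edges of the current node that are still to be examined, `queue` is the FIFO
queue, and `visited` is the set of nodes reached so far. Examining an edge (one coin flip, one
membership test, at most one insertion) costs one step, and so does taking a node out of the
queue. The search ends, with result `visited`, when the queue is empty. -/
noncomputable def reverseBFS {V : Type*} [Fintype V] [DecidableEq V]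
    (G : SocialNetwork V) (U : Finset V) :
    (pending : List (V × V)) → (queue : List V) → (visited : Finset V) → Timed (Finset V)
  | [], [], visited => Timed.ret visited
  | [], u :: queue, visited =>
      Timed.tick 1 (reverseBFS G U (G.inEdges U u).toList queue visited)
  | e :: pending, queue, visited =>
      Timed.bind (Timed.sample 1 (coin (G.prob e))) fun live =>
        if live = true ∧ e.1 ∉ visited then
          reverseBFS G U pending (queue ++ [e.1]) (insert e.1 visited)
        else
          reverseBFS G U pending queue visited
termination_by pending queue visited => (visitedᶜ.card + queue.length, pending.length)
decreasing_by
  · apply Prod.Lex.left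
    simp
  · rename_i h
    have h1 : (insert e.1 visited)ᶜ.card + 1 = visitedᶜ.card := by
      rw [Finset.compl_insert, Finset.card_erase_add_one (Finset.mem_compl.2 h.2)]
    have h2 : (insert e.1 visited)ᶜ.card + (queue ++ [e.1]).length
        = visitedᶜ.card + queue.length := by
      rw [List.length_append, List.length_singleton]
      omega
    rw [h2]
    apply Prod.Lex.right
    simp
  · apply Prod.Lex.right
    simp

/-- The uniform distribution on the `k`-element subsets of `U` (for `k ≤ #U`). -/
noncomputable def uniformSubset (U : Finset V) (k : ℕ) : PMF (Finset V) :=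
  if h : (U.powersetCard k).Nonempty then PMF.uniformOfFinset (U.powersetCard k) h
  else PMF.pure ∅

/-- Generate a random mRR-set of the subgraph induced by `U` for the target `η`, with `n = #U`:
the number `k` of roots is `⌊n / η⌋ + 1` with probability `n / η - ⌊n / η⌋` and `⌊n / η⌋` otherwise
(one step), the `k` roots are a uniformly random `k`-element subset of `U` (`k` steps), and the
nodes that reach them are found by the stochastic reverse breadth-first search. -/
noncomputable def genMRR (G : SocialNetwork V) (U : Finset V) (η : ℕ) : Timed (Finset V) :=
  Timed.bind (Timed.sample 1 (coin (Int.fract ((U.card : ℝ) / η)))) fun up =>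
    let k := if up = true then U.card / η + 1 else U.card / η
    Timed.bind (Timed.sample k (uniformSubset U k)) fun K =>
      reverseBFS G U [] K.toList K

/-- Generate `N` further independent random mRR-sets and add them to the collection `𝓡`. Storing
an mRR-set `R` and updating the coverage counters of its members costs `#R` steps. -/
noncomputable def addMRRs (G : SocialNetwork V) (U : Finset V) (η : ℕ) :
    (N : ℕ) → (𝓡 : List (Finset V)) → Timed (List (Finset V))
  | 0, 𝓡 => Timed.ret 𝓡
  | N + 1, 𝓡 => Timed.bind (genMRR G U η) fun R => Timed.tick R.card (addMRRs G U η N (R :: 𝓡))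

/-- The coverage of `v` in `𝓡`: the number of sets in `𝓡` that contain `v`. -/
def coverage (𝓡 : List (Finset V)) (v : V) : ℕ := 𝓡.countP fun R => v ∈ R

/-- A node of `U` of maximum coverage. -/
noncomputable def argmaxCoverage (U : Finset V) (hU : U.Nonempty) (𝓡 : List (Finset V)) :
    {v : V // v ∈ U} :=
  ⟨(U.exists_max_image (coverage 𝓡) hU).choose, (U.exists_max_image (coverage 𝓡) hU).choose_spec.1⟩

end Algorithm

/-! ### The parameters of TRIM

`n` and `η` are the number of nodes and the target in the graph to which TRIM is applied. -/

namespace TRIM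

/-- `δ = ε / (100 (1 - 1/e) (1 - ε) η)`. -/
noncomputable def delta (η : ℕ) (ε : ℝ) : ℝ :=
  ε / (100 * (1 - 1 / Real.exp 1) * (1 - ε) * η)

/-- The corrected error threshold `99 ε / (100 - ε)`. -/
noncomputable def epsHat (ε : ℝ) : ℝ := 99 * ε / (100 - ε)

/-- The largest number `θ_max` of mRR-sets. -/
noncomputable def thetaMax (n η : ℕ) (ε : ℝ) : ℝ :=
  2 * n * (√(Real.log (6 / delta η ε)) + √(Real.log n + Real.log (6 / delta η ε))) ^ 2
    * ((epsHat ε) ^ 2)⁻¹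

/-- The initial number `θ_∘` of mRR-sets, before rounding. -/
noncomputable def thetaInit (n η : ℕ) (ε : ℝ) : ℝ := thetaMax n η ε * (epsHat ε) ^ 2 / n

/-- The maximum number `T` of iterations. -/
noncomputable def maxIter (n η : ℕ) (ε : ℝ) : ℕ :=
  ⌈Real.logb 2 (thetaMax n η ε / thetaInit n η ε)⌉₊ + 1

/-- `a₁ = ln (3 T / δ) + ln n`. -/
noncomputable def a₁ (n η : ℕ) (ε : ℝ) : ℝ :=
  Real.log (3 * maxIter n η ε / delta η ε) + Real.log n

/-- `a₂ = ln (3 T / δ)`. -/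
noncomputable def a₂ (n η : ℕ) (ε : ℝ) : ℝ := Real.log (3 * maxIter n η ε / delta η ε)

/-- The lower bound `Λˡ` computed from the coverage `c` of the chosen node. -/
noncomputable def lower (n η : ℕ) (ε c : ℝ) : ℝ :=
  (√(c + 2 * a₁ n η ε / 9) - √(a₁ n η ε / 2)) ^ 2 - a₁ n η ε / 18

/-- The upper bound `Λᵘ` computed from the coverage `c` of the chosen node. -/
noncomputable def upper (n η : ℕ) (ε c : ℝ) : ℝ :=
  (√(c + a₂ n η ε / 2) + √(a₂ n η ε / 2)) ^ 2

end TRIM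

section Algorithm

variable {V : Type*} [Fintype V] [DecidableEq V]

/-- The main loop of TRIM, where `j` is the number of iterations left after the current one. An
iteration costs `#U` steps for the maximization of the coverage and one for the stopping test. If
TRIM does not stop, the size of `𝓡` is doubled. -/
noncomputable def trimLoop (G : SocialNetwork V) (U : Finset V) (hU : U.Nonempty) (η : ℕ) (ε : ℝ) :
    (j : ℕ) → (𝓡 : List (Finset V)) → Timed {v : V // v ∈ U}
  | 0, 𝓡 => Timed.tick (U.card + 1) (Timed.ret (argmaxCoverage U hU 𝓡))
  | j + 1, 𝓡 => Timed.tick (U.card + 1) <|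
      let v := argmaxCoverage U hU 𝓡
      if 1 - TRIM.epsHat ε ≤ TRIM.lower U.card η ε (coverage 𝓡 v.1) /
          TRIM.upper U.card η ε (coverage 𝓡 v.1) then
        Timed.ret v
      else
        Timed.bind (addMRRs G U η 𝓡.length 𝓡) fun 𝓡' => trimLoop G U hU η ε j 𝓡'

/-- TRIM on the subgraph of `G` induced by `U`, with target `η` and error threshold `ε`.
Computing the parameters costs one step, and initializing the coverage counters `#U` steps. The
initial number of mRR-sets is `θ_∘`, rounded up. -/
noncomputable def trim (G : SocialNetwork V) (U : Finset V) (hU : U.Nonempty) (η : ℕ) (ε : ℝ) :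
    Timed {v : V // v ∈ U} :=
  Timed.tick (U.card + 1) <|
    Timed.bind (addMRRs G U η ⌈TRIM.thetaInit U.card η ε⌉₊ []) fun 𝓡 =>
      trimLoop G U hU η ε (TRIM.maxIter U.card η ε - 1) 𝓡

/-- The rounds of ASTI instantiated with TRIM under the realization `φ`, from a state in which `U`
is the set of inactive nodes and `S` the set of seeds selected so far. While fewer than `η` nodes
are active, TRIM selects a seed `s` in the residual graph induced by `U`, for the remaining target
`η - (n - #U)`; the nodes that `s` activates in the residual graph are observed and removed. The
observation and the construction of the next residual graph take one step for each node and each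
edge of the residual graph, and one more step is spent on the test. -/
noncomputable def astiRounds (G : SocialNetwork V) (η : ℕ) (ε : ℝ) (φ : Finset (V × V))
    (U : Finset V) (S : Finset V) : Timed (Finset V) :=
  Timed.tick 1 <|
    if h : U.Nonempty ∧ Fintype.card V - U.card < η then
      Timed.bind (trim G U h.1 (η - (Fintype.card V - U.card)) ε) fun s =>
        Timed.tick (U.card + (G.inducedEdges U).card) <|
          astiRounds G η ε φ (U \ activated φ U s.1) (insert s.1 S)
    else Timed.ret S
termination_by U.card
decreasing_by
  apply Finset.card_lt_card
  exact Finset.sdiff_ssubset (activated_subset φ U s.1) ⟨s.1, mem_activated_self φ s.2⟩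

/-- ASTI instantiated with TRIM, with target `η` and error threshold `ε`, when the influence
propagates according to the realization `φ`. Reading the network takes one step for each node and
each edge. The result is the set of seeds. -/
noncomputable def asti (G : SocialNetwork V) (η : ℕ) (ε : ℝ) (φ : Finset (V × V)) :
    Timed (Finset V) :=
  Timed.tick (Fintype.card V + G.edges.card) (astiRounds G η ε φ Finset.univ ∅)

/-- The expected running time of ASTI instantiated with TRIM, over the random realization and the
internal randomness of the algorithm. -/
noncomputable def astiExpectedTime (G : SocialNetwork V) (η : ℕ) (ε : ℝ) : ℝ≥0∞ :=
  ∑ φ ∈ G.edges.powerset,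
    ENNReal.ofReal (G.realizationProb φ) * (asti G η ε φ).expectedSteps

end Algorithm

/-! The point is that the size of the sampling problem cancels in each round. Fix a residual graph
and let `q` be the largest probability, over its nodes, that a random mRR-set contains the node.

Cost of one set: the reverse search pays one step per visited node and one per edge entering it, so
generating and storing a set `R` costs at most the sum of 4 + indegree over `R`. By linearity each
node contributes its weight times its hitting probability, which gives at most q(4n + m) in
expectation (`mrrCost_le`).

Number of sets: TRIM stops as soon as the maximum coverage reaches some K = O(ln N / ε²), with N the
number of nodes of the whole network (`TRIM.stops`). A node with hitting probability `q` has
expected coverage `Nq` among `N` sets, and a Chernoff bound (`mean_coverage_lt_le`) makes a coverage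
below `K` exponentially unlikely once Nq ≥ 4K. Doublings below 4K/q add up geometrically, and each
later one adds at most 4/q expected sets (`expectedDoubling_le`, `sum_doubling_le`). So O(ln N / (ε²
q)) sets are expected, `q` cancels in the product, and a call of TRIM costs O((m + N) ln N / ε²).

Every seed activates at least itself, so there are at most η rounds (`expectedSteps_astiRounds_le`).
The bound holds for each realization, hence for their average. -/

/-! ### Expectations and supports of timed computations. -/

namespace Timed

variable {α β : Type*}

/-- The expectation of a function of the result. -/
noncomputable def mean (x : Timed α) (f : α → ℝ≥0∞) : ℝ≥0∞ := ∑' a : α × ℕ, x a * f a.1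

end Timed

namespace PMF

variable {α β : Type*}

theorem tsum_pure_mul (a : α) (f : α → ℝ≥0∞) : ∑' b, PMF.pure a b * f b = f a := by
  rw [tsum_eq_single a]
  · simp
  · intro b hb
    simp [hb]

theorem tsum_bind_mul (d : PMF α) (g : α → PMF β) (f : β → ℝ≥0∞) :
    ∑' b, d.bind g b * f b = ∑' a, d a * ∑' b, g a b * f b := by
  simp only [PMF.bind_apply, ← ENNReal.tsum_mul_right, ← ENNReal.tsum_mul_left]
  rw [ENNReal.tsum_comm]
  simp only [mul_assoc]

theorem tsum_mul_mono (d : PMF α) {f g : α → ℝ≥0∞} (h : ∀ a ∈ d.support, f a ≤ g a) :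
    ∑' a, d a * f a ≤ ∑' a, d a * g a := by
  refine ENNReal.tsum_le_tsum fun a => ?_
  by_cases ha : d a = 0
  · simp [ha]
  · gcongr
    exact h a ((PMF.mem_support_iff _ _).2 ha)

end PMF

namespace Timed

variable {α β : Type*}

theorem mean_mono_support (x : Timed α) {f g : α → ℝ≥0∞}
    (h : ∀ a ∈ x.support, f a.1 ≤ g a.1) : x.mean f ≤ x.mean g :=
  PMF.tsum_mul_mono x h

theorem mean_congr_support (x : Timed α) {f g : α → ℝ≥0∞}
    (h : ∀ a ∈ x.support, f a.1 = g a.1) : x.mean f = x.mean g :=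
  le_antisymm (mean_mono_support x fun a ha => (h a ha).le)
    (mean_mono_support x fun a ha => (h a ha).ge)

theorem mean_mono (x : Timed α) {f g : α → ℝ≥0∞} (h : ∀ a, f a ≤ g a) : x.mean f ≤ x.mean g :=
  mean_mono_support x fun a _ => h a.1

theorem mean_const (x : Timed α) (c : ℝ≥0∞) : x.mean (fun _ => c) = c := by
  rw [mean, ENNReal.tsum_mul_right, PMF.tsum_coe, one_mul]

theorem mean_le_of_le (x : Timed α) {f : α → ℝ≥0∞} {c : ℝ≥0∞} (h : ∀ a, f a ≤ c) :
    x.mean f ≤ c :=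
  (x.mean_mono h).trans_eq (x.mean_const c)

theorem mean_add (x : Timed α) (f g : α → ℝ≥0∞) :
    x.mean (fun a => f a + g a) = x.mean f + x.mean g := by
  simp only [mean, mul_add, ENNReal.tsum_add]

theorem mean_mul_left (x : Timed α) (c : ℝ≥0∞) (f : α → ℝ≥0∞) :
    x.mean (fun a => c * f a) = c * x.mean f := by
  simp only [mean, ← ENNReal.tsum_mul_left, mul_left_comm c]

theorem mean_mul_right (x : Timed α) (c : ℝ≥0∞) (f : α → ℝ≥0∞) :
    x.mean (fun a => f a * c) = x.mean f * c := by
  simp only [mean, ← ENNReal.tsum_mul_right, mul_assoc]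

theorem mean_sum {ι : Type*} (x : Timed α) (s : Finset ι) (f : ι → α → ℝ≥0∞) :
    x.mean (fun a => ∑ i ∈ s, f i a) = ∑ i ∈ s, x.mean (f i) := by
  classical
  induction s using Finset.induction_on with
  | empty => simp [mean]
  | insert i s hi ih => simp only [Finset.sum_insert hi, mean_add, ih]

theorem mean_ret (a : α) (f : α → ℝ≥0∞) : (ret a).mean f = f a :=
  PMF.tsum_pure_mul (a, 0) fun b => f b.1

theorem mean_bind (x : Timed α) (y : α → Timed β) (f : β → ℝ≥0∞) :
    (x.bind y).mean f = x.mean fun a => (y a).mean f := by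
  rw [mean, Timed.bind, PMF.tsum_bind_mul x _ fun b : β × ℕ => f b.1]
  congr 1; ext a; congr 1
  rw [PMF.tsum_bind_mul _ _ fun b : β × ℕ => f b.1]
  congr 1; ext b; congr 1
  exact PMF.tsum_pure_mul _ fun b : β × ℕ => f b.1

theorem mean_tick (c : ℕ) (x : Timed α) (f : α → ℝ≥0∞) : (tick c x).mean f = x.mean f := by
  rw [mean, tick, PMF.tsum_bind_mul x _ fun b : α × ℕ => f b.1]
  congr 1; ext a; congr 1
  exact PMF.tsum_pure_mul _ fun b : α × ℕ => f b.1

theorem expectedSteps_ret (a : α) : (ret a).expectedSteps = 0 := by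
  exact (PMF.tsum_pure_mul (a, 0) fun b : α × ℕ => (b.2 : ℝ≥0∞)).trans Nat.cast_zero

theorem expectedSteps_tick (c : ℕ) (x : Timed α) :
    (tick c x).expectedSteps = c + x.expectedSteps := by
  rw [expectedSteps, tick, PMF.tsum_bind_mul x _ fun b : α × ℕ => (b.2 : ℝ≥0∞)]
  have h : ∀ a : α × ℕ, x a * ∑' b : α × ℕ, (PMF.pure (a.1, c + a.2)) b * (b.2 : ℝ≥0∞)
      = x a * c + x a * a.2 := fun a => by
    rw [PMF.tsum_pure_mul _ fun b : α × ℕ => (b.2 : ℝ≥0∞)]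
    push_cast
    rw [mul_add]
  rw [tsum_congr h, ENNReal.tsum_add, ENNReal.tsum_mul_right, PMF.tsum_coe, one_mul, expectedSteps]

theorem expectedSteps_bind (x : Timed α) (y : α → Timed β) :
    (x.bind y).expectedSteps = x.expectedSteps + x.mean fun a => (y a).expectedSteps := by
  rw [expectedSteps, Timed.bind, PMF.tsum_bind_mul x _ fun b : β × ℕ => (b.2 : ℝ≥0∞)]
  have h : ∀ a : α × ℕ, x a * ∑' b : β × ℕ, (PMF.bind (y a.1) fun b =>
      PMF.pure (b.1, a.2 + b.2)) b * (b.2 : ℝ≥0∞)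
      = x a * a.2 + x a * (y a.1).expectedSteps := fun a => by
    have h2 := expectedSteps_tick a.2 (y a.1)
    rw [expectedSteps, tick] at h2
    rw [h2, mul_add]
  rw [tsum_congr h, ENNReal.tsum_add, expectedSteps, mean]

theorem mem_support_ret {a : α} {z : α × ℕ} : z ∈ (ret a).support ↔ z = (a, 0) := by
  simp [ret]

theorem mem_support_tick {c : ℕ} {x : Timed α} {z : α × ℕ} :
    z ∈ (tick c x).support ↔ ∃ a ∈ x.support, z = (a.1, c + a.2) := by
  simp only [tick, PMF.mem_support_bind_iff, PMF.mem_support_pure_iff]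

theorem mem_support_sample {c : ℕ} {d : PMF α} {z : α × ℕ} :
    z ∈ (sample c d).support ↔ ∃ a ∈ d.support, z = (a, c) := by
  simp only [sample, PMF.mem_support_bind_iff, PMF.mem_support_pure_iff]

theorem mem_support_bind {x : Timed α} {y : α → Timed β} {z : β × ℕ} :
    z ∈ (x.bind y).support ↔
      ∃ a ∈ x.support, ∃ b ∈ (y a.1).support, z = (b.1, a.2 + b.2) := by
  simp only [Timed.bind, PMF.mem_support_bind_iff, PMF.mem_support_pure_iff]

end Timed

/-- Needed for target 1, where rounding the number of roots up would ask for more roots than there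
are nodes. -/
theorem coin_zero_support : true ∉ (coin 0).support := by
  rw [PMF.mem_support_iff, not_not]
  simp [coin, PMF.ofFintype_apply]

theorem mem_support_uniformSubset {V : Type*} {U K : Finset V} {k : ℕ} (hk : k ≤ U.card)
    (hK : K ∈ (uniformSubset U k).support) : K ⊆ U ∧ K.card = k := by
  rw [uniformSubset, dif_pos (Finset.powersetCard_nonempty.2 hk),
    PMF.mem_support_uniformOfFinset_iff, Finset.mem_powersetCard] at hK
  exact hK

/-! ### Cost of generating one mRR-set. -/

section ReverseBFS

variable {V : Type*} [Fintype V] [DecidableEq V]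

/-- The search makes one step for each pending edge, and `1 + indegree` steps for each node that is
or will be queued. -/
theorem reverseBFS_support (G : SocialNetwork V) (U : Finset V) (pending : List (V × V))
    (queue : List V) (visited : Finset V) : (∀ e ∈ pending, e.1 ∈ U) → visited ⊆ U →
    ∀ z ∈ (reverseBFS G U pending queue visited).support, visited ⊆ z.1 ∧ z.1 ⊆ U ∧
      z.2 = pending.length + (queue.map fun u => 1 + (G.inEdges U u).card).sum
        + ∑ u ∈ z.1 \ visited, (1 + (G.inEdges U u).card) := by
  fun_induction reverseBFS G U pending queue visited with
  | case1 visited =>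
    intro hp hv z hz
    rw [Timed.mem_support_ret] at hz
    subst hz
    simp [hv]
  | case2 u queue visited ih =>
    intro hp hv z hz
    rw [Timed.mem_support_tick] at hz
    obtain ⟨a, ha, rfl⟩ := hz
    obtain ⟨h1, h2, h3⟩ := ih (by
      intro e he
      simp only [SocialNetwork.inEdges, SocialNetwork.inducedEdges, Finset.mem_toList,
        Finset.mem_filter] at he
      exact he.1.2.1) hv a ha
    refine ⟨h1, h2, ?_⟩
    simp only [h3, Finset.length_toList, List.map_cons, List.sum_cons, List.length_nil]
    omega
  | case3 e pending queue visited ih1 ih2 =>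
    intro hp hv z hz
    rw [Timed.mem_support_bind] at hz
    obtain ⟨⟨live, c⟩, ha, b, hb, rfl⟩ := hz
    rw [Timed.mem_support_sample] at ha
    obtain ⟨live', -, hl⟩ := ha
    obtain ⟨rfl, rfl⟩ := Prod.mk.inj hl
    simp only at hb
    split_ifs at hb with hc
    · obtain ⟨h1, h2, h3⟩ := ih1 live hc (fun e' he' => hp e' (List.mem_cons_of_mem _ he'))
        (Finset.insert_subset (hp e List.mem_cons_self) hv) b hb
      refine ⟨(Finset.subset_insert _ _).trans h1, h2, ?_⟩
      -- The newly reached node moves from the sum over nodes still to be reached to the queue, with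
      -- the same charge.
      have h4 : b.1 \ visited = insert e.1 (b.1 \ insert e.1 visited) := by
        ext w
        simp only [Finset.mem_sdiff, Finset.mem_insert]
        by_cases hw : w = e.1
        · subst hw
          simp [hc.2, h1 (Finset.mem_insert_self _ _)]
        · simp [hw]
      rw [h4, Finset.sum_insert (by simp)]
      simp only [h3, List.map_append, List.sum_append, List.map_cons, List.map_nil,
        List.sum_cons, List.sum_nil, List.length_cons]
      omega
    · obtain ⟨h1, h2, h3⟩ := ih2 (fun e' he' => hp e' (List.mem_cons_of_mem _ he')) hv b hb
      refine ⟨h1, h2, ?_⟩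
      simp only [h3, List.length_cons]
      omega

/-- A generated mRR-set is a nonempty set of nodes of the residual graph, and the number of steps
spent on it is controlled by its size and by the number of edges that enter it. -/
theorem genMRR_support (G : SocialNetwork V) (U : Finset V) (η : ℕ) (hη : 1 ≤ η)
    (hηU : η ≤ U.card) (z : Finset V × ℕ) (hz : z ∈ (genMRR G U η).support) :
    z.1 ⊆ U ∧ 1 ≤ z.1.card ∧ z.2 ≤ ∑ u ∈ z.1, (3 + (G.inEdges U u).card) := by
  rw [genMRR, Timed.mem_support_bind] at hz
  obtain ⟨⟨up, c⟩, hup, ⟨b, s⟩, hb, rfl⟩ := hz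
  rw [Timed.mem_support_sample] at hup
  obtain ⟨up', hup, hl⟩ := hup
  obtain ⟨rfl, rfl⟩ := Prod.mk.inj hl
  simp only at hb
  set k := if up = true then U.card / η + 1 else U.card / η with hk
  have hdiv : 1 ≤ U.card / η := (Nat.one_le_div_iff hη).2 hηU
  have hk1 : 1 ≤ k := by rw [hk]; split_ifs <;> omega
  -- Rounding up is harmless for η ≥ 2, as n / 2 + 1 ≤ n; for η = 1 the fractional part is zero and
  -- the coin never shows heads.
  have hkU : k ≤ U.card := by
    rw [hk]
    split_ifs with h
    · have hη2 : 2 ≤ η := by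
        by_contra hcon
        obtain rfl : η = 1 := by omega
        simp only [Nat.cast_one, div_one, Int.fract_natCast, h] at hup
        exact coin_zero_support hup
      have := Nat.div_le_div_left (a := U.card) hη2 two_pos
      omega
    · exact Nat.div_le_self _ _
  rw [Timed.mem_support_bind] at hb
  obtain ⟨⟨K, c⟩, hK, ⟨R, s'⟩, hR, hl⟩ := hb
  rw [Timed.mem_support_sample] at hK
  obtain ⟨K', hK, hl'⟩ := hK
  obtain ⟨rfl, rfl⟩ := Prod.mk.inj hl'
  obtain ⟨rfl, rfl⟩ := Prod.mk.inj hl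
  obtain ⟨hKU, hKc⟩ := mem_support_uniformSubset hkU hK
  obtain ⟨h1, h2, h3⟩ := reverseBFS_support G U [] K.toList K (by simp) hKU _ hR
  simp only at h1 h2 h3 ⊢
  have hcard : k ≤ b.card := hKc ▸ Finset.card_le_card h1
  refine ⟨h2, hk1.trans hcard, ?_⟩
  have h4 : (K.toList.map fun u => 1 + (G.inEdges U u).card).sum
      = ∑ u ∈ K, (1 + (G.inEdges U u).card) := by
    rw [Finset.sum_map_toList]
  have h5 := Finset.sum_sdiff (f := fun u => 1 + (G.inEdges U u).card) h1
  -- The extra 2 per node pays for the coin and the `k` root draws: 1 + k is at most twice the size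
  -- of the set.
  have h6 : ∑ u ∈ b, (3 + (G.inEdges U u).card)
      = 2 * b.card + ∑ u ∈ b, (1 + (G.inEdges U u).card) := by
    rw [mul_comm, ← smul_eq_mul, ← Finset.sum_const, ← Finset.sum_add_distrib]
    exact Finset.sum_congr rfl fun u _ => by omega
  rw [h4] at h3
  rw [h6, h3, List.length_nil]
  omega

end ReverseBFS

/-! ### Size of the parameters, and the stopping test. -/

namespace TRIM

theorem delta_pos {η : ℕ} {ε : ℝ} (hη : 1 ≤ η) (hε : 0 < ε) (hε1 : ε < 1) : 0 < delta η ε := by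
  have he : 1 < Real.exp 1 := Real.one_lt_exp_iff.2 one_pos
  have h1 : 0 < 1 - 1 / Real.exp 1 := sub_pos.2 ((div_lt_one (by positivity)).2 he)
  have h2 : 0 < 1 - ε := sub_pos.2 hε1
  have h3 : (0 : ℝ) < η := by exact_mod_cast hη
  unfold delta
  positivity

/-- 6/δ is at most 600 η/ε, where 600 ≤ 2^10 ≤ N^10, η ≤ N and 1/ε ≤ N^κ. This is where the inverse
polynomial threshold turns ln(1/ε) into O(ln N). -/
theorem log_six_div_delta_le {N η κ : ℕ} {ε : ℝ} (hN : 2 ≤ N) (hη : 1 ≤ η) (hηN : η ≤ N)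
    (hε : 0 < ε) (hε1 : ε < 1) (hκ : 1 / (N : ℝ) ^ κ ≤ ε) :
    Real.log (6 / delta η ε) ≤ (κ + 11) * Real.log N := by
  have hδ := delta_pos hη hε hε1
  have hN2 : (2 : ℝ) ≤ N := by exact_mod_cast hN
  have hNpos : (0 : ℝ) < N := by linarith
  have hηN' : (η : ℝ) ≤ N := by exact_mod_cast hηN
  have hη' : (0 : ℝ) < η := by exact_mod_cast hη
  have he : 0 < 1 / Real.exp 1 := by positivity
  have he1 : 0 < 1 - 1 / Real.exp 1 :=
    sub_pos.2 ((div_lt_one (by positivity)).2 (Real.one_lt_exp_iff.2 one_pos))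
  have hinv : 1 / ε ≤ (N : ℝ) ^ κ := by
    rw [div_le_iff₀ (by positivity)] at hκ
    rw [div_le_iff₀ hε]
    linarith
  have h : 6 / delta η ε ≤ (N : ℝ) ^ (κ + 11) := by
    have h1 : 6 / delta η ε = 600 * ((1 - 1 / Real.exp 1) * (1 - ε)) * η * (1 / ε) := by
      have h2 : 1 - ε ≠ 0 := by linarith
      unfold delta
      field_simp
      ring
    have h2 : (1 - 1 / Real.exp 1) * (1 - ε) ≤ 1 :=
      mul_le_one₀ (by linarith) (by linarith) (by linarith)
    have h3 : (600 : ℝ) ≤ (N : ℝ) ^ 10 :=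
      (by norm_num : (600 : ℝ) ≤ 2 ^ 10).trans (pow_le_pow_left₀ (by norm_num) hN2 10)
    calc 6 / delta η ε = 600 * ((1 - 1 / Real.exp 1) * (1 - ε)) * η * (1 / ε) := h1
      _ ≤ 600 * 1 * N * (N : ℝ) ^ κ := by gcongr
      _ ≤ (N : ℝ) ^ 10 * 1 * N * (N : ℝ) ^ κ := by gcongr
      _ = (N : ℝ) ^ (κ + 11) := by ring
  calc Real.log (6 / delta η ε) ≤ Real.log ((N : ℝ) ^ (κ + 11)) :=
        Real.log_le_log (by positivity) h
    _ = (κ + 11) * Real.log N := by rw [Real.log_pow]; push_cast; ring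

theorem epsHat_pos {ε : ℝ} (hε : 0 < ε) (hε1 : ε < 1) : 0 < epsHat ε :=
  div_pos (by linarith) (by linarith)

theorem epsHat_le_one {ε : ℝ} (hε1 : ε < 1) : epsHat ε ≤ 1 := by
  unfold epsHat
  rw [div_le_one (by linarith)]
  linarith

theorem le_epsHat {ε : ℝ} (hε : 0 < ε) (hε1 : ε < 1) : 99 / 100 * ε ≤ epsHat ε := by
  unfold epsHat
  rw [le_div_iff₀ (by linarith)]
  nlinarith

theorem thetaInit_eq {n η : ℕ} {ε : ℝ} (hn : 1 ≤ n) (hε : 0 < ε) (hε1 : ε < 1) :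
    thetaInit n η ε =
      2 * (√(Real.log (6 / delta η ε)) + √(Real.log n + Real.log (6 / delta η ε))) ^ 2 := by
  have h1 := (epsHat_pos hε hε1).ne'
  have h2 : (n : ℝ) ≠ 0 := by positivity
  unfold thetaInit thetaMax
  field_simp

theorem thetaInit_le {N n η κ : ℕ} {ε : ℝ} (hN : 2 ≤ N) (hn : 1 ≤ n) (hnN : n ≤ N) (hη : 1 ≤ η)
    (hηN : η ≤ N) (hε : 0 < ε) (hε1 : ε < 1) (hκ : 1 / (N : ℝ) ^ κ ≤ ε) :
    thetaInit n η ε ≤ 8 * (κ + 12) * Real.log N := by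
  have hL := log_six_div_delta_le hN hη hηN hε hε1 hκ
  have hn' : (0 : ℝ) < n := by exact_mod_cast hn
  have hlogn : Real.log n ≤ Real.log N := Real.log_le_log hn' (by exact_mod_cast hnN)
  have hN0 : 0 ≤ Real.log N := Real.log_natCast_nonneg N
  rw [thetaInit_eq hn hε hε1]
  have h1 : √(Real.log (6 / delta η ε)) ≤ √((κ + 12) * Real.log N) :=
    Real.sqrt_le_sqrt (by linarith)
  have h2 : √(Real.log n + Real.log (6 / delta η ε)) ≤ √((κ + 12) * Real.log N) :=
    Real.sqrt_le_sqrt (by linarith)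
  calc 2 * (√(Real.log (6 / delta η ε)) + √(Real.log n + Real.log (6 / delta η ε))) ^ 2
      ≤ 2 * (√((κ + 12) * Real.log N) + √((κ + 12) * Real.log N)) ^ 2 := by gcongr
    _ = 8 * √((κ + 12) * Real.log N) ^ 2 := by ring
    _ = 8 * (κ + 12) * Real.log N := by rw [Real.sq_sqrt (by positivity)]; ring

/-- If the error threshold is so close to one that the logarithms are negative, then TRIM generates
no mRR-set and has a single iteration. -/
theorem degenerate {n η : ℕ} {ε : ℝ} (hn : 1 ≤ n) (hε : 0 < ε) (hε1 : ε < 1)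
    (h : Real.log n + Real.log (6 / delta η ε) ≤ 0) :
    thetaInit n η ε = 0 ∧ maxIter n η ε = 1 := by
  have hL : Real.log (6 / delta η ε) ≤ 0 := by linarith [Real.log_natCast_nonneg n]
  have h0 : thetaInit n η ε = 0 := by
    rw [thetaInit_eq hn hε hε1, Real.sqrt_eq_zero_of_nonpos h, Real.sqrt_eq_zero_of_nonpos hL]
    simp
  exact ⟨h0, by simp [maxIter, h0]⟩

/-- The ratio of the two sample sizes is n/ε̂², which is polynomial in `N`, so its binary logarithm
is O(ln N). -/
theorem maxIter_le {N n η κ : ℕ} {ε : ℝ} (hN : 2 ≤ N) (hn : 1 ≤ n) (hnN : n ≤ N)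
    (hε : 0 < ε) (hε1 : ε < 1) (hκ : 1 / (N : ℝ) ^ κ ≤ ε) :
    (maxIter n η ε : ℝ) ≤ (4 * κ + 10) * Real.log N := by
  have hN2 : (2 : ℝ) ≤ N := by exact_mod_cast hN
  have hNpos : (0 : ℝ) < N := by linarith
  have hn' : (1 : ℝ) ≤ n := by exact_mod_cast hn
  have hnN' : (n : ℝ) ≤ N := by exact_mod_cast hnN
  have hl2 : (0.6931471803 : ℝ) < Real.log 2 := Real.log_two_gt_d9
  have hlN : Real.log 2 ≤ Real.log N := Real.log_le_log two_pos hN2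
  have he := epsHat_pos hε hε1
  have he1 := epsHat_le_one hε1
  have hκ0 : (0 : ℝ) ≤ κ := Nat.cast_nonneg κ
  have hbig : 1 ≤ (4 * κ + 10) * Real.log N := by nlinarith [mul_nonneg hκ0 (by linarith : 0 ≤ Real.log N)]
  -- Here the quotient and its logarithm take the default value 0, and T = 1.
  by_cases h0 : thetaInit n η ε = 0
  · rw [maxIter, h0]
    simpa using hbig
  have hratio : thetaMax n η ε / thetaInit n η ε = n / epsHat ε ^ 2 := by
    have hM : thetaMax n η ε ≠ 0 := fun h => h0 (by simp [thetaInit, h])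
    have : (n : ℝ) ≠ 0 := by positivity
    unfold thetaInit
    field_simp
  have hge : 1 ≤ n / epsHat ε ^ 2 := by
    rw [le_div_iff₀ (by positivity), one_mul]
    exact (pow_le_one₀ he.le he1).trans hn'
  have hinv : 1 / epsHat ε ≤ (N : ℝ) ^ (κ + 1) := by
    have hk : 1 ≤ ε * (N : ℝ) ^ κ := by rwa [div_le_iff₀ (by positivity)] at hκ
    have hk2 := le_epsHat hε hε1
    rw [div_le_iff₀ he]
    have hp : (0 : ℝ) < (N : ℝ) ^ κ := by positivity
    calc (1 : ℝ) ≤ ε * (N : ℝ) ^ κ := hk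
      _ ≤ (2 * epsHat ε) * (N : ℝ) ^ κ := by gcongr; linarith
      _ ≤ (N * epsHat ε) * (N : ℝ) ^ κ := by gcongr
      _ = (N : ℝ) ^ (κ + 1) * epsHat ε := by ring
  have hle : n / epsHat ε ^ 2 ≤ (N : ℝ) ^ (2 * κ + 3) := by
    calc n / epsHat ε ^ 2 = n * (1 / epsHat ε) ^ 2 := by field_simp
      _ ≤ N * ((N : ℝ) ^ (κ + 1)) ^ 2 := by gcongr
      _ = (N : ℝ) ^ (2 * κ + 3) := by ring
  have hlog : Real.logb 2 (n / epsHat ε ^ 2) ≤ (4 * κ + 6) * Real.log N := by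
    rw [Real.logb, div_le_iff₀ (by linarith)]
    have h1 : Real.log (n / epsHat ε ^ 2) ≤ (2 * κ + 3) * Real.log N := by
      refine (Real.log_le_log (by linarith) hle).trans_eq ?_
      rw [Real.log_pow]; push_cast; ring
    -- Passing to base 2 at most doubles the bound, since ln 2 > 1/2.
    refine h1.trans ?_
    have h2 : 0 ≤ (2 * κ + 3) * Real.log N := by positivity
    nlinarith
  have hlog0 : 0 ≤ Real.logb 2 (n / epsHat ε ^ 2) := Real.logb_nonneg one_lt_two hge
  rw [maxIter, hratio]
  push_cast
  have := (Nat.ceil_lt_add_one hlog0).le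
  linarith

theorem a₂_eq {n η : ℕ} {ε : ℝ} (hη : 1 ≤ η) (hε : 0 < ε) (hε1 : ε < 1) :
    a₂ n η ε = Real.log (6 / delta η ε) + Real.log (maxIter n η ε / 2) := by
  have hδ := delta_pos hη hε hε1
  have hT : (0 : ℝ) < maxIter n η ε := by unfold maxIter; positivity
  rw [← Real.log_mul (by positivity) (by positivity), a₂]
  congr 1
  field_simp
  ring

/-- Absolute values are needed because δ is large for ε near 1, so ln(6/δ) may be negative; `h`
keeps it above -ln n. -/
theorem abs_a_le {N n η κ : ℕ} {ε : ℝ} (hN : 2 ≤ N) (hn : 1 ≤ n) (hnN : n ≤ N) (hη : 1 ≤ η)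
    (hηN : η ≤ N) (hε : 0 < ε) (hε1 : ε < 1) (hκ : 1 / (N : ℝ) ^ κ ≤ ε)
    (h : 0 < Real.log n + Real.log (6 / delta η ε)) :
    |a₁ n η ε| ≤ (3 * κ + 17) * Real.log N ∧ |a₂ n η ε| ≤ (3 * κ + 17) * Real.log N := by
  have hL := log_six_div_delta_le hN hη hηN hε hε1 hκ
  have hT := maxIter_le (η := η) hN hn hnN hε hε1 hκ
  have hT1 : (1 : ℝ) ≤ maxIter n η ε := by unfold maxIter; push_cast; linarith [Nat.cast_nonneg (α := ℝ) ⌈Real.logb 2 (thetaMax n η ε / thetaInit n η ε)⌉₊]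
  have hn' : (0 : ℝ) < n := by exact_mod_cast hn
  have hlogn : Real.log n ≤ Real.log N := Real.log_le_log hn' (by exact_mod_cast hnN)
  have hlogn0 : 0 ≤ Real.log n := Real.log_natCast_nonneg n
  have hl2 : Real.log 2 ≤ Real.log N := Real.log_le_log two_pos (by exact_mod_cast hN)
  have hu : Real.log (maxIter n η ε / 2) ≤ (2 * κ + 5) * Real.log N := by
    have := Real.log_le_sub_one_of_pos (x := maxIter n η ε / 2) (by linarith)
    linarith
  have hl : -Real.log 2 ≤ Real.log (maxIter n η ε / 2) := by
    rw [Real.log_div (by linarith) two_ne_zero]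
    linarith [Real.log_nonneg hT1]
  have hκN : 0 ≤ κ * Real.log N := mul_nonneg (Nat.cast_nonneg κ) (by linarith)
  have ha : a₁ n η ε = a₂ n η ε + Real.log n := rfl
  rw [ha, a₂_eq hη hε hε1, abs_le, abs_le]
  refine ⟨⟨?_, ?_⟩, ?_, ?_⟩ <;> linarith

/-- If the logarithmic terms are at most `A` in absolute value, then a coverage of at least
`36 A / ε̂ ^ 2` makes TRIM stop. -/
theorem stops {n η : ℕ} {ε A c : ℝ} (he : 0 < epsHat ε) (he1 : epsHat ε ≤ 1) (hA : 0 < A)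
    (h1 : |a₁ n η ε| ≤ A) (h2 : |a₂ n η ε| ≤ A) (hc : 36 * A / epsHat ε ^ 2 ≤ c) :
    1 - epsHat ε ≤ lower n η ε c / upper n η ε c := by
  rw [abs_le] at h1 h2
  set e := epsHat ε
  set x := a₁ n η ε with hx
  set y := a₂ n η ε with hy
  rw [div_le_iff₀ (by positivity)] at hc
  have hcpos : 0 < c := by
    by_contra hcon
    nlinarith [mul_nonneg (neg_nonneg.2 (not_lt.1 hcon)) (sq_nonneg e)]
  have he2 : e ^ 2 ≤ 1 := pow_le_one₀ he.le he1
  have hcA : 36 * A ≤ c := by nlinarith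
  set s := √(c * A) with hs
  have hs0 : 0 ≤ s := Real.sqrt_nonneg _
  have hs2 : s ^ 2 = c * A := Real.sq_sqrt (by positivity)
  have hsle : s ≤ e * c / 6 := by
    refine Real.sqrt_le_iff.2 ⟨by positivity, ?_⟩
    nlinarith
  have hlow : c - A - 2 * s ≤ lower n η ε c := by
    unfold lower
    rw [← hx]
    -- For negative `x` the root of x/2 is 0 by convention and the cross term disappears; likewise
    -- for `y` below.
    rcases le_total 0 x with h | h
    · have h3 : √(c + 2 * x / 9) ^ 2 = c + 2 * x / 9 := Real.sq_sqrt (by positivity)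
      have h4 : √(x / 2) ^ 2 = x / 2 := Real.sq_sqrt (by positivity)
      have h5 : √(c + 2 * x / 9) * √(x / 2) ≤ s := by
        rw [← Real.sqrt_mul (by positivity)]
        refine Real.sqrt_le_sqrt ?_
        nlinarith
      nlinarith
    · have h3 : √(c + 2 * x / 9) ^ 2 = c + 2 * x / 9 := Real.sq_sqrt (by linarith)
      rw [Real.sqrt_eq_zero_of_nonpos (by linarith : x / 2 ≤ 0)]
      nlinarith
  have hup : 0 < upper n η ε c ∧ upper n η ε c ≤ c + A + 2 * s := by
    unfold upper
    rw [← hy]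
    have h3 : √(c + y / 2) ^ 2 = c + y / 2 := Real.sq_sqrt (by linarith)
    have h0 : 0 < √(c + y / 2) := Real.sqrt_pos.2 (by linarith)
    refine ⟨by positivity, ?_⟩
    rcases le_total 0 y with h | h
    · have h4 : √(y / 2) ^ 2 = y / 2 := Real.sq_sqrt (by positivity)
      have h5 : √(c + y / 2) * √(y / 2) ≤ s := by
        rw [← Real.sqrt_mul (by positivity)]
        refine Real.sqrt_le_sqrt ?_
        nlinarith
      nlinarith
    · rw [Real.sqrt_eq_zero_of_nonpos (by linarith : y / 2 ≤ 0)]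
      nlinarith
  rw [le_div_iff₀ hup.1]
  have h6 : (1 - e) * upper n η ε c ≤ (1 - e) * (c + A + 2 * s) :=
    mul_le_mul_of_nonneg_left hup.2 (by linarith)
  have h7 : 36 * A ≤ e * c := by nlinarith
  nlinarith [mul_nonneg he.le (by positivity : 0 ≤ A + 2 * s)]

end TRIM

/-! ### Expected number and expected cost of the mRR-sets. -/

section Sampling

variable {V : Type*} [Fintype V] [DecidableEq V]

/-- The expected cost of generating and storing one mRR-set. -/
noncomputable def mrrCost (G : SocialNetwork V) (U : Finset V) (η : ℕ) : ℝ≥0∞ :=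
  (genMRR G U η).expectedSteps + (genMRR G U η).mean fun R => (R.card : ℝ≥0∞)

/-- The probability that a random mRR-set contains `u`. -/
noncomputable def hitProb (G : SocialNetwork V) (U : Finset V) (η : ℕ) (u : V) : ℝ≥0∞ :=
  (genMRR G U η).mean fun R => if u ∈ R then 1 else 0

theorem hitProb_le_one (G : SocialNetwork V) (U : Finset V) (η : ℕ) (u : V) :
    hitProb G U η u ≤ 1 :=
  Timed.mean_le_of_le _ fun R => by split_ifs <;> simp

/-- The expected weight of a random mRR-set, for additive weights. -/
theorem mean_genMRR_sum (G : SocialNetwork V) (U : Finset V) (η : ℕ) (hη : 1 ≤ η)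
    (hηU : η ≤ U.card) (w : V → ℝ≥0∞) :
    ((genMRR G U η).mean fun R => ∑ u ∈ R, w u) = ∑ u ∈ U, hitProb G U η u * w u := by
  simp only [hitProb, ← Timed.mean_mul_right]
  rw [← Timed.mean_sum]
  refine Timed.mean_congr_support _ fun z hz => ?_
  obtain ⟨h1, -, -⟩ := genMRR_support G U η hη hηU z hz
  simp only [ite_mul, one_mul, zero_mul]
  rw [← Finset.sum_filter, Finset.filter_mem_eq_inter, Finset.inter_eq_right.2 h1]

theorem sum_inEdges_card_le {V : Type*} [DecidableEq V] (G : SocialNetwork V) (U : Finset V) :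
    ∑ u ∈ U, (G.inEdges U u).card ≤ G.edges.card := by
  have h := Finset.card_eq_sum_card_fiberwise (s := G.inducedEdges U) (t := U)
    (f := fun e : V × V => e.2) fun e he => by
      simp only [SocialNetwork.inducedEdges, Finset.coe_filter, Set.mem_ofPred_eq] at he
      exact he.2.2
  exact h.symm.trans_le (Finset.card_filter_le _ _)

/-- The sum is the expected size of an mRR-set, which is never empty. It makes the largest hitting
probability positive, so that one can divide by it. -/
theorem one_le_sum_hitProb (G : SocialNetwork V) (U : Finset V) (η : ℕ) (hη : 1 ≤ η)
    (hηU : η ≤ U.card) : 1 ≤ ∑ u ∈ U, hitProb G U η u := by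
  have h := mean_genMRR_sum G U η hη hηU fun _ => 1
  simp only [mul_one, Finset.sum_const, nsmul_eq_mul] at h
  rw [← h]
  refine (Timed.mean_const (genMRR G U η) 1).symm.trans_le (Timed.mean_mono_support _ fun z hz => ?_)
  obtain ⟨-, h2, -⟩ := genMRR_support G U η hη hηU z hz
  exact_mod_cast h2

/-- The expected cost of an mRR-set is at most the largest hitting probability times the size of the
network. -/
theorem mrrCost_le (G : SocialNetwork V) (U : Finset V) (η : ℕ) (hη : 1 ≤ η) (hηU : η ≤ U.card)
    (q : ℝ≥0∞) (hq : ∀ u ∈ U, hitProb G U η u ≤ q) :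
    mrrCost G U η ≤ q * (4 * U.card + G.edges.card) := by
  have h1 : (genMRR G U η).expectedSteps ≤
      (genMRR G U η).mean fun R => ∑ u ∈ R, ((3 + (G.inEdges U u).card : ℕ) : ℝ≥0∞) :=
    PMF.tsum_mul_mono _ fun z hz => by
      obtain ⟨-, -, h⟩ := genMRR_support G U η hη hηU z hz
      exact (Nat.cast_le.2 h).trans_eq (Nat.cast_sum _ _)
  have h2 : ((genMRR G U η).mean fun R => (R.card : ℝ≥0∞))
      = (genMRR G U η).mean fun R => ∑ u ∈ R, (1 : ℝ≥0∞) := by simp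
  rw [mrrCost, h2]
  refine (add_le_add_left h1 _).trans ?_
  rw [mean_genMRR_sum G U η hη hηU, mean_genMRR_sum G U η hη hηU, ← Finset.sum_add_distrib]
  calc ∑ u ∈ U, (hitProb G U η u * ((3 + (G.inEdges U u).card : ℕ) : ℝ≥0∞)
        + hitProb G U η u * 1)
      ≤ ∑ u ∈ U, q * ((4 + (G.inEdges U u).card : ℕ) : ℝ≥0∞) := by
        refine Finset.sum_le_sum fun u hu => ?_
        rw [← mul_add]
        refine mul_le_mul' (hq u hu) (le_of_eq ?_)
        push_cast
        ring
    _ = q * ((∑ u ∈ U, (4 + (G.inEdges U u).card) : ℕ) : ℝ≥0∞) := by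
        rw [← Finset.mul_sum, ← Nat.cast_sum]
    _ ≤ q * ((4 * U.card + G.edges.card : ℕ) : ℝ≥0∞) := by
        gcongr
        rw [Finset.sum_add_distrib, Finset.sum_const, smul_eq_mul, mul_comm U.card]
        exact Nat.add_le_add_left (sum_inEdges_card_le G U) _
    _ = q * (4 * U.card + G.edges.card) := by push_cast; rfl

theorem expectedSteps_addMRRs (G : SocialNetwork V) (U : Finset V) (η N : ℕ)
    (𝓡 : List (Finset V)) : (addMRRs G U η N 𝓡).expectedSteps = N * mrrCost G U η := by
  induction N generalizing 𝓡 with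
  | zero => simp [addMRRs, Timed.expectedSteps_ret]
  | succ N ih =>
    simp only [addMRRs, Timed.expectedSteps_bind, Timed.expectedSteps_tick, ih, Timed.mean_add,
      Timed.mean_const, mrrCost]
    push_cast
    ring

theorem mean_addMRRs_mono (G : SocialNetwork V) (U : Finset V) (η N : ℕ) (𝓡 : List (Finset V))
    {f g : List (Finset V) → ℝ≥0∞} (h : ∀ 𝓡', 𝓡'.length = 𝓡.length + N → f 𝓡' ≤ g 𝓡') :
    (addMRRs G U η N 𝓡).mean f ≤ (addMRRs G U η N 𝓡).mean g := by
  induction N generalizing 𝓡 with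
  | zero => simpa only [addMRRs, Timed.mean_ret] using h 𝓡 rfl
  | succ N ih =>
    simp only [addMRRs, Timed.mean_bind, Timed.mean_tick]
    refine Timed.mean_mono _ fun R => ?_
    exact ih (R :: 𝓡) fun 𝓡' h' => h 𝓡' (by rw [h', List.length_cons]; omega)

/-- Allows a collection grown by doubling to be treated as one fresh independent sample of its final
size. -/
theorem mean_addMRRs_add (G : SocialNetwork V) (U : Finset V) (η N M : ℕ) (𝓡 : List (Finset V))
    (f : List (Finset V) → ℝ≥0∞) :
    ((addMRRs G U η N 𝓡).mean fun 𝓡' => (addMRRs G U η M 𝓡').mean f)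
      = (addMRRs G U η (N + M) 𝓡).mean f := by
  induction N generalizing 𝓡 with
  | zero => simp only [addMRRs, Timed.mean_ret, zero_add]
  | succ N ih =>
    rw [Nat.succ_add]
    simp only [addMRRs, Timed.mean_bind, Timed.mean_tick, ih]

/-- The exponential moment for the Chernoff bound: by independence each new set contributes one
factor. -/
theorem mean_half_pow_coverage (G : SocialNetwork V) (U : Finset V) (η N : ℕ)
    (𝓡 : List (Finset V)) (v : V) :
    ((addMRRs G U η N 𝓡).mean fun 𝓡' => (2⁻¹ : ℝ≥0∞) ^ coverage 𝓡' v)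
      = 2⁻¹ ^ coverage 𝓡 v * ((genMRR G U η).mean fun R => if v ∈ R then 2⁻¹ else 1) ^ N := by
  induction N generalizing 𝓡 with
  | zero => simp only [addMRRs, Timed.mean_ret, pow_zero, mul_one]
  | succ N ih =>
    simp only [addMRRs, Timed.mean_bind, Timed.mean_tick, ih]
    rw [Timed.mean_mul_right, pow_succ', ← mul_assoc, ← Timed.mean_mul_left]
    congr 2
    ext R
    rw [coverage, List.countP_cons]
    by_cases h : v ∈ R <;> simp [h, pow_succ, coverage]

/-- The mean equals 1 - q/2 for the hitting probability `q`, and 1 + x ≤ exp x. -/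
theorem mean_half_le (G : SocialNetwork V) (U : Finset V) (η : ℕ) (v : V) :
    ((genMRR G U η).mean fun R => if v ∈ R then 2⁻¹ else 1)
      ≤ ENNReal.ofReal (Real.exp (-(hitProb G U η v).toReal / 2)) := by
  set r := (genMRR G U η).mean fun R => if v ∈ R then (2⁻¹ : ℝ≥0∞) else 1 with hr
  have h : r + 2⁻¹ * hitProb G U η v = 1 := by
    rw [hr, hitProb, ← Timed.mean_mul_left, ← Timed.mean_add]
    refine Eq.trans ?_ (Timed.mean_const (genMRR G U η) 1)
    congr 1
    ext R
    split_ifs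
    · rw [mul_one, ENNReal.inv_two_add_inv_two]
    · simp
  have hq : hitProb G U η v ≠ ∞ := ne_top_of_le_ne_top ENNReal.one_ne_top (hitProb_le_one G U η v)
  have hrt : r ≠ ∞ := fun hcon => by simp [hcon] at h
  have h2 := congrArg ENNReal.toReal h
  rw [ENNReal.toReal_add hrt (ENNReal.mul_ne_top (by simp) hq), ENNReal.toReal_mul,
    ENNReal.toReal_inv, ENNReal.toReal_ofNat, ENNReal.toReal_one] at h2
  refine ENNReal.le_ofReal_iff_toReal_le hrt (Real.exp_pos _).le |>.2 ?_
  have := Real.add_one_le_exp (-(hitProb G U η v).toReal / 2)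
  linarith

/-- The coverage of a node is rarely much smaller than its expectation. -/
theorem mean_coverage_lt_le (G : SocialNetwork V) (U : Finset V) (η N : ℕ) (v : V) (K : ℝ)
    (hK : 4 * K ≤ N * (hitProb G U η v).toReal) :
    ((addMRRs G U η N []).mean fun 𝓡 => if (coverage 𝓡 v : ℝ) < K then 1 else 0)
      ≤ ENNReal.ofReal (Real.exp (-(N * (hitProb G U η v).toReal / 4))) := by
  set q := (hitProb G U η v).toReal
  -- Markov's inequality for 2^(-coverage), with 2^K relaxed to exp K. The final exponent K - Nq/2
  -- is at most -Nq/4 by `hK`.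
  have h1 : ∀ 𝓡 : List (Finset V), (if (coverage 𝓡 v : ℝ) < K then 1 else 0)
      ≤ ENNReal.ofReal (Real.exp K) * (2⁻¹ : ℝ≥0∞) ^ coverage 𝓡 v := fun 𝓡 => by
    split_ifs with h
    · have h2 : (2 : ℝ) ^ coverage 𝓡 v ≤ Real.exp K := by
        calc (2 : ℝ) ^ coverage 𝓡 v ≤ Real.exp 1 ^ coverage 𝓡 v :=
              pow_le_pow_left₀ (by norm_num) (by linarith [Real.add_one_le_exp (1 : ℝ)]) _
          _ = Real.exp (coverage 𝓡 v) := by rw [← Real.exp_nat_mul, mul_one]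
          _ ≤ Real.exp K := Real.exp_le_exp.2 h.le
      have h3 : (2 : ℝ≥0∞) ^ coverage 𝓡 v ≤ ENNReal.ofReal (Real.exp K) := by
        rw [← ENNReal.ofReal_ofNat, ← ENNReal.ofReal_pow (by norm_num)]
        exact ENNReal.ofReal_le_ofReal h2
      calc (1 : ℝ≥0∞) = 2 ^ coverage 𝓡 v * 2⁻¹ ^ coverage 𝓡 v := by
            rw [← mul_pow, ENNReal.mul_inv_cancel two_ne_zero ENNReal.ofNat_ne_top, one_pow]
        _ ≤ _ := by gcongr
    · exact zero_le
  calc ((addMRRs G U η N []).mean fun 𝓡 => if (coverage 𝓡 v : ℝ) < K then 1 else 0)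
      ≤ (addMRRs G U η N []).mean fun 𝓡 =>
          ENNReal.ofReal (Real.exp K) * (2⁻¹ : ℝ≥0∞) ^ coverage 𝓡 v := Timed.mean_mono _ h1
    _ = ENNReal.ofReal (Real.exp K) *
          ((genMRR G U η).mean fun R => if v ∈ R then 2⁻¹ else 1) ^ N := by
        rw [Timed.mean_mul_left, mean_half_pow_coverage]
        simp [coverage]
    _ ≤ ENNReal.ofReal (Real.exp K) * ENNReal.ofReal (Real.exp (-q / 2)) ^ N := by
        gcongr
        exact mean_half_le G U η v
    _ = ENNReal.ofReal (Real.exp (K + N * (-q / 2))) := by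
        rw [← ENNReal.ofReal_pow (Real.exp_pos _).le, ← Real.exp_nat_mul,
          ← ENNReal.ofReal_mul (Real.exp_pos _).le, ← Real.exp_add]
    _ ≤ ENNReal.ofReal (Real.exp (-(N * q / 4))) := by
        refine ENNReal.ofReal_le_ofReal (Real.exp_le_exp.2 ?_)
        linarith

/-- The stopping test of TRIM fails on the collection `𝓡`. -/
def TRIM.Continues (U : Finset V) (hU : U.Nonempty) (η : ℕ) (ε : ℝ) (𝓡 : List (Finset V)) :
    Prop :=
  ¬ 1 - TRIM.epsHat ε ≤ TRIM.lower U.card η ε (coverage 𝓡 (argmaxCoverage U hU 𝓡).1) /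
    TRIM.upper U.card η ε (coverage 𝓡 (argmaxCoverage U hU 𝓡).1)

open Classical in
/-- The expected number of mRR-sets added by a doubling step from `N` mRR-sets, if it is reached. -/
noncomputable def expectedDoubling (G : SocialNetwork V) (U : Finset V) (hU : U.Nonempty) (η : ℕ)
    (ε : ℝ) (N : ℕ) : ℝ≥0∞ :=
  ((addMRRs G U η N []).mean fun 𝓡 => if TRIM.Continues U hU η ε 𝓡 then 1 else 0) * N

theorem coverage_le_argmaxCoverage {V : Type*} [DecidableEq V] {U : Finset V} (hU : U.Nonempty) (𝓡 : List (Finset V)) {v : V}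
    (hv : v ∈ U) : coverage 𝓡 v ≤ coverage 𝓡 (argmaxCoverage U hU 𝓡).1 :=
  (U.exists_max_image (coverage 𝓡) hU).choose_spec.2 v hv

/-- Below the threshold the failure probability is bounded by 1. Above it, failure forces the
coverage of `v` below `K`, and N exp(-Nq/4) ≤ 4/q because x ≤ exp x. -/
theorem expectedDoubling_le (G : SocialNetwork V) (U : Finset V) (hU : U.Nonempty) (η : ℕ)
    (ε : ℝ) (N : ℕ) {v : V} (hv : v ∈ U) {K q : ℝ} (hq : (hitProb G U η v).toReal = q)
    (hq0 : 0 < q)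
    (hK : ∀ c : ℝ, K ≤ c → 1 - TRIM.epsHat ε ≤
      TRIM.lower U.card η ε c / TRIM.upper U.card η ε c) :
    expectedDoubling G U hU η ε N
      ≤ ENNReal.ofReal ((if (N : ℝ) < 4 * K / q then (N : ℝ) else 0) + 4 / q) := by
  classical
  unfold expectedDoubling
  split_ifs with h
  · calc _ ≤ 1 * (N : ℝ≥0∞) := by
          gcongr
          exact Timed.mean_le_of_le _ fun 𝓡 => by split_ifs <;> simp
      _ = ENNReal.ofReal N := by simp
      _ ≤ _ := ENNReal.ofReal_le_ofReal (by linarith [div_pos four_pos hq0])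
  · have h4 : 4 * K ≤ N * q := by rwa [not_lt, div_le_iff₀ hq0] at h
    have h1 := mean_coverage_lt_le G U η N v K (by rwa [hq])
    rw [hq] at h1
    have h2 : ((addMRRs G U η N []).mean fun 𝓡 => if TRIM.Continues U hU η ε 𝓡 then 1 else 0)
        ≤ (addMRRs G U η N []).mean fun 𝓡 => if (coverage 𝓡 v : ℝ) < K then 1 else 0 := by
      refine Timed.mean_mono _ fun 𝓡 => ?_
      by_cases hc : (coverage 𝓡 v : ℝ) < K
      · rw [if_pos hc]
        split_ifs <;> simp
      · rw [if_neg fun hcon => hcon (hK _ ((not_lt.1 hc).trans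
          (by exact_mod_cast coverage_le_argmaxCoverage hU 𝓡 hv)))]
        exact zero_le
    calc _ ≤ ENNReal.ofReal (Real.exp (-(N * q / 4))) * ENNReal.ofReal N := by
          rw [ENNReal.ofReal_natCast]
          gcongr
          exact h2.trans h1
      _ = ENNReal.ofReal (Real.exp (-(N * q / 4)) * N) :=
          (ENNReal.ofReal_mul (Real.exp_pos _).le).symm
      _ ≤ _ := by
          refine ENNReal.ofReal_le_ofReal ?_
          rw [zero_add, le_div_iff₀ hq0, Real.exp_neg, ← div_eq_inv_mul, div_mul_eq_mul_div,
            div_le_iff₀ (Real.exp_pos _)]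
          linarith [Real.add_one_le_exp (N * q / 4)]

theorem sum_doubling_le (N j : ℕ) {X : ℝ} (hX : 0 ≤ X) :
    ∑ i ∈ Finset.range j,
      (if ((2 ^ i * N : ℕ) : ℝ) < X then ((2 ^ i * N : ℕ) : ℝ) else 0) ≤ 2 * X := by
  -- The second bound carries the induction: the terms before a term smaller than `X` sum to at most
  -- that term.
  suffices h : ∑ i ∈ Finset.range j,
      (if ((2 ^ i * N : ℕ) : ℝ) < X then ((2 ^ i * N : ℕ) : ℝ) else 0) ≤ 2 * X ∧
      ∑ i ∈ Finset.range j,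
      (if ((2 ^ i * N : ℕ) : ℝ) < X then ((2 ^ i * N : ℕ) : ℝ) else 0)
        ≤ ((2 ^ j * N : ℕ) : ℝ) from h.1
  induction j with
  | zero => simp [hX]
  | succ j ih =>
    rw [Finset.sum_range_succ]
    have h0 : (0 : ℝ) ≤ ((2 ^ j * N : ℕ) : ℝ) := Nat.cast_nonneg _
    have h1 : ((2 ^ (j + 1) * N : ℕ) : ℝ) = 2 * ((2 ^ j * N : ℕ) : ℝ) := by push_cast; ring
    rw [h1]
    split_ifs with h
    · constructor <;> linarith [ih.2]
    · constructor <;> linarith [ih.1, ih.2]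

/-- The expected cost of the main loop of TRIM, started on `N` random mRR-sets. -/
theorem mean_expectedSteps_trimLoop_le (G : SocialNetwork V) (U : Finset V) (hU : U.Nonempty)
    (η : ℕ) (ε : ℝ) (j N : ℕ) :
    ((addMRRs G U η N []).mean fun 𝓡 => (trimLoop G U hU η ε j 𝓡).expectedSteps)
      ≤ (j + 1 : ℕ) * (U.card + 1 : ℕ)
        + (∑ i ∈ Finset.range j, expectedDoubling G U hU η ε (2 ^ i * N)) * mrrCost G U η := by
  classical
  induction j generalizing N with
  | zero =>
    simp [trimLoop, Timed.expectedSteps_tick, Timed.expectedSteps_ret, Timed.mean_const]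
  | succ j ih =>
    -- The remaining iterations are charged even if the test succeeds. This overestimate removes the
    -- conditioning on earlier failures: each doubling is weighted by the failure probability on an
    -- unconditioned sample.
    have hstep : ∀ 𝓡 : List (Finset V), 𝓡.length = ([] : List (Finset V)).length + N →
        (trimLoop G U hU η ε (j + 1) 𝓡).expectedSteps ≤ ((U.card + 1 : ℕ) : ℝ≥0∞)
          + (if TRIM.Continues U hU η ε 𝓡 then 1 else 0) * (N * mrrCost G U η)
          + (addMRRs G U η N 𝓡).mean fun 𝓡' => (trimLoop G U hU η ε j 𝓡').expectedSteps := by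
      intro 𝓡 hlen
      rw [List.length_nil, zero_add] at hlen
      rw [trimLoop, Timed.expectedSteps_tick, add_assoc]
      refine add_le_add_right ?_ _
      by_cases hc : TRIM.Continues U hU η ε 𝓡
      · rw [if_pos hc]
        simp only [TRIM.Continues] at hc
        simp only [if_neg hc, Timed.expectedSteps_bind, expectedSteps_addMRRs, hlen, one_mul, le_refl]
      · rw [if_neg hc]
        simp only [TRIM.Continues, not_not] at hc
        simp only [if_pos hc, Timed.expectedSteps_ret]
        exact zero_le
    refine (mean_addMRRs_mono G U η N [] hstep).trans ?_
    rw [Timed.mean_add, Timed.mean_add, Timed.mean_const, Timed.mean_mul_right, mean_addMRRs_add]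
    refine (add_le_add_right (ih (N + N)) _).trans (le_of_eq ?_)
    rw [Finset.sum_range_succ', expectedDoubling]
    have h2 : ∀ i, 2 ^ i * (N + N) = 2 ^ (i + 1) * N := fun i => by ring
    simp only [h2, pow_zero, one_mul]
    push_cast
    ring

end Sampling

/-! ### Running time of TRIM and of ASTI. -/

section RunningTime

variable {V : Type*} [Fintype V] [DecidableEq V]

theorem expectedSteps_trim_le_cost (G : SocialNetwork V) (U : Finset V) (hU : U.Nonempty) (η : ℕ)
    (ε : ℝ) {j : ℕ} (hj : TRIM.maxIter U.card η ε = j + 1) :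
    (trim G U hU η ε).expectedSteps ≤ (j + 2 : ℕ) * (U.card + 1 : ℕ)
      + ((⌈TRIM.thetaInit U.card η ε⌉₊ : ℝ≥0∞) + ∑ i ∈ Finset.range j,
        expectedDoubling G U hU η ε (2 ^ i * ⌈TRIM.thetaInit U.card η ε⌉₊)) * mrrCost G U η := by
  rw [trim, Timed.expectedSteps_tick, Timed.expectedSteps_bind, expectedSteps_addMRRs, hj,
    Nat.add_sub_cancel]
  refine (add_le_add_right (add_le_add_right
    (mean_expectedSteps_trimLoop_le G U hU η ε j _) _) _).trans (le_of_eq ?_)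
  push_cast
  ring

/-- The expected running time of one call of TRIM. -/
theorem expectedSteps_trim_le (κ : ℕ) (G : SocialNetwork V) (U : Finset V) (hU : U.Nonempty)
    (η : ℕ) (ε : ℝ) (hN : 2 ≤ Fintype.card V) (hη : 1 ≤ η) (hηU : η ≤ U.card) (hε : 0 < ε)
    (hε1 : ε < 1) (hκ : 1 / (Fintype.card V : ℝ) ^ κ ≤ ε) :
    (trim G U hU η ε).expectedSteps ≤ ENNReal.ofReal (8000 * (κ + 6) *
      (((G.edges.card : ℝ) + Fintype.card V) / ε ^ 2 * Real.log (Fintype.card V))) := by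
  obtain ⟨v, hv, hmax⟩ := U.exists_max_image (hitProb G U η) hU
  set N := Fintype.card V with hNdef
  set n := U.card with hn_def
  set m : ℝ := (G.edges.card : ℝ) with hm
  set l := Real.log N with hl
  have hn : 1 ≤ n := hU.card_pos
  have hnN : n ≤ N := Finset.card_le_univ U
  have hn' : (1 : ℝ) ≤ n := by exact_mod_cast hn
  have hnN' : (n : ℝ) ≤ N := by exact_mod_cast hnN
  have hm0 : 0 ≤ m := Nat.cast_nonneg _
  have hκ0 : (0 : ℝ) ≤ κ := Nat.cast_nonneg _
  have hl2 : 1 / 2 < l :=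
    (by linarith [Real.log_two_gt_d9] : 1 / 2 < Real.log 2).trans_le
      (Real.log_le_log two_pos (by exact_mod_cast hN))
  have hκl : 0 ≤ κ * l := mul_nonneg hκ0 (by linarith)
  have hqtop : hitProb G U η v ≠ ∞ :=
    ne_top_of_le_ne_top ENNReal.one_ne_top (hitProb_le_one G U η v)
  set q := (hitProb G U η v).toReal with hq
  have hq1 : q ≤ 1 := ENNReal.toReal_le_of_le_ofReal zero_le_one
    (by simpa using hitProb_le_one G U η v)
  have hq0 : 0 < q := by
    refine ENNReal.toReal_pos (fun h0 => ?_) hqtop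
    have h := one_le_sum_hitProb G U η hη hηU
    rw [Finset.sum_eq_zero fun u hu => le_antisymm ((hmax u hu).trans_eq h0) zero_le] at h
    exact absurd h (by simp)
  have hcost : mrrCost G U η ≤ ENNReal.ofReal (q * (4 * n + m)) := by
    refine (mrrCost_le G U η hη hηU _ hmax).trans_eq ?_
    rw [ENNReal.ofReal_mul hq0.le, hq, ENNReal.ofReal_toReal hqtop,
      ENNReal.ofReal_add (by positivity) hm0, ENNReal.ofReal_mul (by norm_num)]
    simp [hm, hn_def]
  obtain ⟨j, hj⟩ : ∃ j, TRIM.maxIter n η ε = j + 1 := ⟨_, rfl⟩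
  set θ := ⌈TRIM.thetaInit n η ε⌉₊ with hθ
  -- Twice the 36 of `TRIM.stops`, to replace ε̂² by ε² through ε² ≤ 2ε̂².
  set K : ℝ := 72 * ((3 * κ + 17) * l) / ε ^ 2 with hK
  have hK0 : 0 ≤ K := by positivity
  have hT : ((j : ℝ) + 1) ≤ (4 * κ + 10) * l := by
    have h := TRIM.maxIter_le (η := η) hN hn hnN hε hε1 hκ
    rw [hj] at h
    exact_mod_cast h
  have hθle : (θ : ℝ) ≤ (8 * κ + 98) * l := by
    have h := TRIM.thetaInit_le hN hn hnN hη (hηU.trans hnN) hε hε1 hκ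
    have h0 : 0 ≤ TRIM.thetaInit n η ε := by
      rw [TRIM.thetaInit_eq hn hε hε1]
      positivity
    have := (Nat.ceil_lt_add_one h0).le
    linarith
  have hsum : ∑ i ∈ Finset.range j, expectedDoubling G U hU η ε (2 ^ i * θ)
      ≤ ENNReal.ofReal (2 * (4 * K / q) + j * (4 / q)) := by
    -- In the first case `TRIM.abs_a_le` is not available, but there is a single iteration and hence
    -- no doubling.
    rcases le_or_gt (Real.log n + Real.log (6 / TRIM.delta η ε)) 0 with hdeg | hdeg
    · have h := (TRIM.degenerate hn hε hε1 hdeg).2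
      obtain rfl : j = 0 := by omega
      simp
    · obtain ⟨ha1, ha2⟩ := TRIM.abs_a_le hN hn hnN hη (hηU.trans hnN) hε hε1 hκ hdeg
      have he := TRIM.epsHat_pos hε hε1
      have htest : ∀ c : ℝ, K ≤ c → 1 - TRIM.epsHat ε ≤
          TRIM.lower n η ε c / TRIM.upper n η ε c := fun c hc => by
        refine TRIM.stops he (TRIM.epsHat_le_one hε1) (by positivity) ha1 ha2 (le_trans ?_ hc)
        rw [hK, div_le_div_iff₀ (by positivity) (by positivity)]
        have h1 : ε ^ 2 ≤ 2 * TRIM.epsHat ε ^ 2 := by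
          have h2 := pow_le_pow_left₀ (by positivity) (TRIM.le_epsHat hε hε1) 2
          nlinarith [sq_nonneg ε]
        have h3 : 0 ≤ 36 * ((3 * κ + 17) * l) := by positivity
        calc 36 * ((3 * κ + 17) * l) * ε ^ 2
            ≤ 36 * ((3 * κ + 17) * l) * (2 * TRIM.epsHat ε ^ 2) :=
              mul_le_mul_of_nonneg_left h1 h3
          _ = 72 * ((3 * κ + 17) * l) * TRIM.epsHat ε ^ 2 := by ring
      refine (Finset.sum_le_sum fun i _ =>
        expectedDoubling_le G U hU η ε (2 ^ i * θ) hv hq.symm hq0 htest).trans ?_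
      rw [← ENNReal.ofReal_sum_of_nonneg fun i _ => by positivity]
      refine ENNReal.ofReal_le_ofReal ?_
      rw [Finset.sum_add_distrib, Finset.sum_const, Finset.card_range, nsmul_eq_mul]
      exact add_le_add_left (sum_doubling_le θ j (by positivity)) _
  have hε2 : 1 ≤ 1 / ε ^ 2 := by
    rw [le_div_iff₀ (by positivity), one_mul]
    exact pow_le_one₀ hε.le hε1.le
  refine (expectedSteps_trim_le_cost G U hU η ε hj).trans ?_
  calc _ ≤ ENNReal.ofReal ((j + 2 : ℕ) * (n + 1 : ℕ)) +
        (ENNReal.ofReal θ + ENNReal.ofReal (2 * (4 * K / q) + j * (4 / q)))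
          * ENNReal.ofReal (q * (4 * n + m)) := by
        refine add_le_add (le_of_eq ?_) (mul_le_mul' (add_le_add (le_of_eq ?_) hsum) hcost)
        · rw [← Nat.cast_mul, ← Nat.cast_mul, ENNReal.ofReal_natCast]
        · rw [ENNReal.ofReal_natCast]
    _ = ENNReal.ofReal ((j + 2 : ℕ) * (n + 1 : ℕ)
          + (θ + (2 * (4 * K / q) + j * (4 / q))) * (q * (4 * n + m))) := by
        rw [← ENNReal.ofReal_add (by positivity) (by positivity),
          ← ENNReal.ofReal_mul (by positivity), ← ENNReal.ofReal_add (by positivity) (by positivity)]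
    _ ≤ _ := by
        refine ENNReal.ofReal_le_ofReal ?_
        -- The hitting probability cancels, except in the initial sample, where q ≤ 1 suffices.
        have h1 : (θ + (2 * (4 * K / q) + j * (4 / q))) * (q * (4 * n + m))
            = (θ * q + 8 * K + 4 * j) * (4 * n + m) := by
          field_simp
          ring
        have h2 : (θ : ℝ) * q ≤ (8 * κ + 98) * l * (1 / ε ^ 2) := by
          calc (θ : ℝ) * q ≤ θ * 1 := by gcongr
            _ ≤ (8 * κ + 98) * l * 1 := by linarith
            _ ≤ _ := by gcongr
        have h3 : (j : ℝ) + 2 ≤ (4 * κ + 12) * l * (1 / ε ^ 2) := by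
          calc (j : ℝ) + 2 ≤ (4 * κ + 12) * l * 1 := by linarith
            _ ≤ _ := by gcongr
        have h4 : K = 72 * (3 * κ + 17) * l * (1 / ε ^ 2) := by rw [hK]; ring
        rw [h1, h4]
        push_cast
        calc ((j : ℝ) + 2) * (n + 1)
              + (θ * q + 8 * (72 * (3 * κ + 17) * l * (1 / ε ^ 2)) + 4 * j) * (4 * n + m)
            ≤ (4 * κ + 12) * l * (1 / ε ^ 2) * (2 * (m + N))
              + ((8 * κ + 98) * l * (1 / ε ^ 2) + 8 * (72 * (3 * κ + 17) * l * (1 / ε ^ 2))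
                + 4 * ((4 * κ + 12) * l * (1 / ε ^ 2))) * (4 * (m + N)) := by
              gcongr
              · linarith
              · linarith
              · linarith
          _ = (7016 * κ + 39776) * ((m + N) * (l * (1 / ε ^ 2))) := by ring
          _ ≤ (8000 * (κ + 6)) * ((m + N) * (l * (1 / ε ^ 2))) := by
              gcongr
              linarith
          _ = 8000 * (κ + 6) * ((m + N) / ε ^ 2 * l) := by ring

/-- ASTI runs TRIM at most as many times as there are nodes left to activate. -/
theorem expectedSteps_astiRounds_le (G : SocialNetwork V) (η : ℕ) (ε : ℝ) (φ : Finset (V × V))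
    (hη : η ≤ Fintype.card V) {B : ℝ≥0∞}
    (hB : ∀ (U : Finset V) (hU : U.Nonempty) (η' : ℕ), 1 ≤ η' → η' ≤ U.card →
      (trim G U hU η' ε).expectedSteps ≤ B) (U S : Finset V) :
    (astiRounds G η ε φ U S).expectedSteps ≤ 1 + (η - (Fintype.card V - U.card) : ℕ)
      * (1 + B + (Fintype.card V + G.edges.card : ℕ)) := by
  induction hk : U.card using Nat.strong_induction_on generalizing U S with
  | _ k ih =>
    have hUV : U.card ≤ Fintype.card V := Finset.card_le_univ U
    rw [astiRounds, Timed.expectedSteps_tick, Nat.cast_one]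
    refine add_le_add_right ?_ _
    split_ifs with h
    · obtain ⟨r, hr⟩ : ∃ r, η - (Fintype.card V - k) = r + 1 :=
        Nat.exists_eq_succ_of_ne_zero (by omega)
      rw [Timed.expectedSteps_bind, hr]
      have hround : ∀ s : {v : V // v ∈ U},
          (Timed.tick (U.card + (G.inducedEdges U).card)
            (astiRounds G η ε φ (U \ activated φ U s.1) (insert s.1 S))).expectedSteps
          ≤ (Fintype.card V + G.edges.card : ℕ)
            + (1 + r * (1 + B + (Fintype.card V + G.edges.card : ℕ))) := by
        intro s
        have hlt : (U \ activated φ U s.1).card < U.card := Finset.card_lt_card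
          (Finset.sdiff_ssubset (activated_subset φ U s.1) ⟨s.1, mem_activated_self φ s.2⟩)
        -- By `hlt` the remaining target after the round is at most `r`, so the induction hypothesis
        -- applies with `r` rounds.
        rw [Timed.expectedSteps_tick]
        refine add_le_add ?_ ((ih _ (hk ▸ hlt) _ _ rfl).trans ?_)
        · exact_mod_cast Nat.add_le_add hUV (Finset.card_filter_le _ _)
        · gcongr
          omega
      refine (add_le_add (hB U h.1 _ (by omega) (by omega))
        (Timed.mean_le_of_le _ hround)).trans (le_of_eq ?_)
      push_cast
      ring
    · rw [Timed.expectedSteps_ret]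
      exact zero_le

/-- Expand the product of p(e) + (1 - p(e)) = 1 over all edges. -/
theorem sum_realizationProb {V : Type*} [DecidableEq V] (G : SocialNetwork V) :
    ∑ φ ∈ G.edges.powerset, ENNReal.ofReal (G.realizationProb φ) = 1 := by
  have h := Finset.prod_add G.prob (fun e => 1 - G.prob e) G.edges
  rw [Finset.prod_congr rfl fun e _ => add_sub_cancel (G.prob e) 1, Finset.prod_const_one] at h
  rw [← ENNReal.ofReal_sum_of_nonneg]
  · rw [← ENNReal.ofReal_one, h]
    rfl
  · intro φ hφ
    refine mul_nonneg (Finset.prod_nonneg fun e he => ?_) (Finset.prod_nonneg fun e he => ?_)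
    · exact (G.prob_pos e (Finset.mem_powerset.1 hφ he)).le
    · exact sub_nonneg.2 (G.prob_le_one e (Finset.mem_sdiff.1 he).1)

end RunningTime

theorem theorem4 (κ : ℕ) :
    ∃ C : ℝ, 0 < C ∧
      ∀ (V : Type*) [Fintype V] [DecidableEq V] (G : SocialNetwork V) (η : ℕ) (ε : ℝ),
        2 ≤ Fintype.card V → 1 ≤ η → η ≤ Fintype.card V →
        0 < ε → ε < 1 → 1 / (Fintype.card V : ℝ) ^ κ ≤ ε →
        astiExpectedTime G η ε ≤
          ENNReal.ofReal (C * ((η : ℝ) * ((G.edges.card : ℝ) + (Fintype.card V : ℝ)) / ε ^ 2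
            * Real.log (Fintype.card V : ℝ))) := by
  -- The first summand is the constant of one call of TRIM. The 8 covers reading, observing and
  -- testing: at most 4M steps per round with M = m + n, and M ≤ 2(M/ε²) ln n since ln n > 1/2.
  refine ⟨8000 * (κ + 6) + 8, by positivity, ?_⟩
  intro V _ _ G η ε hN hη hηN hε hε1 hκ
  set N := Fintype.card V
  set l := Real.log N
  obtain ⟨B, hB⟩ : ∃ B, B = 8000 * (κ + 6) * (((G.edges.card : ℝ) + N) / ε ^ 2 * l) := ⟨_, rfl⟩
  have hl2 : 1 / 2 < l :=
    (by linarith [Real.log_two_gt_d9] : 1 / 2 < Real.log 2).trans_le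
      (Real.log_le_log two_pos (by exact_mod_cast hN))
  have hB0 : 0 ≤ B := by rw [hB]; positivity
  have hN' : (2 : ℝ) ≤ N := by exact_mod_cast hN
  have hη' : (1 : ℝ) ≤ η := by exact_mod_cast hη
  have hφ : ∀ φ, (asti G η ε φ).expectedSteps ≤ ENNReal.ofReal ((8000 * (κ + 6) + 8) *
      ((η : ℝ) * ((G.edges.card : ℝ) + N) / ε ^ 2 * l)) := by
    intro φ
    have h := expectedSteps_astiRounds_le G η ε φ hηN (B := ENNReal.ofReal B)
      (fun U hU η' h1 h2 => hB ▸ expectedSteps_trim_le κ G U hU η' ε hN h1 h2 hε hε1 hκ) Finset.univ ∅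
    rw [Finset.card_univ, Nat.sub_self, Nat.sub_zero] at h
    rw [asti, Timed.expectedSteps_tick]
    refine (add_le_add_right h _).trans ?_
    have heq : ((N + G.edges.card : ℕ) : ℝ≥0∞)
          + (1 + η * (1 + ENNReal.ofReal B + (N + G.edges.card : ℕ)))
        = ENNReal.ofReal ((N + G.edges.card : ℕ) + (1 + η * (1 + B + (N + G.edges.card : ℕ)))) := by
      rw [ENNReal.ofReal_add (by positivity) (by positivity),
        ENNReal.ofReal_add (by positivity) (by positivity), ENNReal.ofReal_mul (by positivity),
        ENNReal.ofReal_add (by positivity) (by positivity),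
        ENNReal.ofReal_add (by positivity) (by positivity)]
      simp only [ENNReal.ofReal_natCast, ENNReal.ofReal_one]
    rw [heq]
    refine ENNReal.ofReal_le_ofReal ?_
    push_cast
    set M : ℝ := (G.edges.card : ℝ) + N with hM
    have hM2 : 2 ≤ M := by linarith [Nat.cast_nonneg (α := ℝ) G.edges.card]
    have hε2 : 1 ≤ 1 / ε ^ 2 := by
      rw [le_div_iff₀ (by positivity), one_mul]
      exact pow_le_one₀ hε.le hε1.le
    have h2 : M ≤ 2 * (M / ε ^ 2 * l) := by
      calc M = 2 * (M * 1 * (1 / 2)) := by ring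
        _ ≤ 2 * (M * (1 / ε ^ 2) * l) := by gcongr
        _ = 2 * (M / ε ^ 2 * l) := by ring
    calc (N : ℝ) + G.edges.card + (1 + η * (1 + B + (N + G.edges.card)))
        = 1 * (1 + M) + η * (1 + M + B) := by rw [hM]; ring
      _ ≤ η * (2 * M) + η * (2 * M + B) := by gcongr <;> linarith
      _ = η * (4 * M + B) := by ring
      _ ≤ η * (4 * (2 * (M / ε ^ 2 * l)) + B) := by gcongr
      _ = (8000 * (κ + 6) + 8) * (η * M / ε ^ 2 * l) := by rw [hB]; ring
  calc astiExpectedTime G η ε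
      ≤ ∑ φ ∈ G.edges.powerset, ENNReal.ofReal (G.realizationProb φ) * ENNReal.ofReal
          ((8000 * (κ + 6) + 8) * ((η : ℝ) * ((G.edges.card : ℝ) + N) / ε ^ 2 * l)) :=
        Finset.sum_le_sum fun φ _ => mul_le_mul_right (hφ φ) _
    _ = _ := by rw [← Finset.sum_mul, sum_realizationProb, one_mul]
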